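/- Let $R:\mathbb R\times\mathbb R^m\to\mathbb R^m$ and $G:\mathbb R^m\to\mathbb R$ be smooth ($C^\infty$), $G$ not necessarily convex, and let $G$ be an invariant of $\dot q=R(t,q)$ on $[0,T]$, i.e. $\nabla G(q)^TR(t,q)=0$ for all $t\in[0,T]$ and $q\in\mathbb R^m$. Consider an explicit $s$-stage Runge-Kutta method with coefficients $a_{ij}$ ($a_{ij}=0$ for $j\ge i$), weights $b_j$ and abscissae $c_i=\sum_j a_{ij}$, of order of accuracy $p\ge 2$: for every smooth initial value problem the error after one step of size $\Delta t$ is $O(\Delta t^{p+1})$ as $\Delta t\to0^+$. Let $t_n\in[0,T)$, $q^n\in\mathbb R^m$ and let $$R_i=R\Bigl(t_n+c_i\Delta t,\;q^n+\Delta t\sum_j a_{ij}R_j\Bigr),\qquad q^{n+1}=q^n+\Delta t\sum_j b_jR_j$$ be the stage derivatives and the Runge-Kutta solution for step size $\Delta t$ from $(t_n,q^n)$. Let $\nabla G_s$ be the orthogonal projection of $\nabla G(q^{n+1})$ onto $\mathcal S=\mathrm{span}(R_1,\dots,R_s)$, and let $q(\cdot)$ be the exact solution of $\dot q=R(t,q)$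 with $q(t_n)=q^n$. Assume the condition under which the relaxation method (projection of $q^{n+1}$ along $q^{n+1}-q^n$) is solvable and accurate: for some constant $c\ne0$, $$\nabla G(q^{n+1})^T\,\frac{q^{n+1}-q^n}{\|q^{n+1}-q^n\|_2}=c\,\Delta t+O(\Delta t^2)\qquad(\Delta t\to0^+).$$ Then there are $h^*>0$, $\delta>0$ and $C>0$ such that for every $\Delta t\in(0,h^*]$: 1. $\nabla G_s\neq0$; 2. the quasi-orthogonal projection is solvable: there is exactly one $\lambda_n$ with $|\lambda_n|\le\delta\Delta t$ such that $\hat q^{n+1}=q^{n+1}+\lambda_n\nabla G_s/\|\nabla G_s\|_2$ satisfies $G(\hat q^{n+1})=G(q^n)$; 3. the order of accuracy is kept at the fixed step size: $\|\hat q^{n+1}-q(t_n+\Delta t)\|_2\le C\,\Delta t^{p+1}$. -/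

import Mathlib

open Filter Topology Asymptotics
open scoped ContDiff

/-- An explicit Runge-Kutta method with `s` stages: coefficients `a i j` (strictly lower
triangular), weights `b j`. -/
structure ExplicitRK (s : ℕ) where
  a : Fin s → Fin s → ℝ
  b : Fin s → ℝ
  explicit : ∀ i j : Fin s, i ≤ j → a i j = 0

namespace ExplicitRK

variable {s m : ℕ}

/-- The abscissae `c i = ∑ j, a i j`. -/
def c (M : ExplicitRK s) (i : Fin s) : ℝ := ∑ j, M.a i j

/-- The stage derivative `R_i` of one step of size `h` from `(t, q)`. Since the method is explicit,
only the stages `j < i` enter; see `stage_eq` for the usual form. -/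
noncomputable def stage (M : ExplicitRK s)
    (R : ℝ → EuclideanSpace ℝ (Fin m) → EuclideanSpace ℝ (Fin m))
    (t : ℝ) (q : EuclideanSpace ℝ (Fin m)) (h : ℝ) (i : Fin s) : EuclideanSpace ℝ (Fin m) :=
  R (t + M.c i * h)
    (q + h • ∑ j : Fin i.val,
      M.a i ⟨j.val, j.isLt.trans i.isLt⟩ • M.stage R t q h ⟨j.val, j.isLt.trans i.isLt⟩)
termination_by i.val
decreasing_by exact j.isLt

/-- The stage derivatives satisfy
`R_i = R (t + c_i h, q_i)`, `q_i = q + h ∑ j, a_ij R_j`, with the sum over all stages. -/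
theorem stage_eq (M : ExplicitRK s)
    (R : ℝ → EuclideanSpace ℝ (Fin m) → EuclideanSpace ℝ (Fin m))
    (t : ℝ) (q : EuclideanSpace ℝ (Fin m)) (h : ℝ) (i : Fin s) :
    M.stage R t q h i =
      R (t + M.c i * h) (q + h • ∑ j, M.a i j • M.stage R t q h j) := by
  rw [stage]
  congr 3
  refine Finset.sum_of_injOn (fun j : Fin i.val => (⟨j.val, j.isLt.trans i.isLt⟩ : Fin s))
    ?_ ?_ ?_ ?_
  · intro x _ y _ hxy
    simpa [Fin.ext_iff] using hxy
  · intro x _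
    simp
  · intro j _ hj
    have hij : i ≤ j := by
      by_contra hlt
      exact hj ⟨⟨j.val, not_le.mp hlt⟩, by simp, rfl⟩
    rw [M.explicit i j hij, zero_smul]
  · intro x _
    rfl

/-- The Runge-Kutta solution `q^{n+1}` after one step of size `h` from `(t, q)`. -/
noncomputable def step (M : ExplicitRK s)
    (R : ℝ → EuclideanSpace ℝ (Fin m) → EuclideanSpace ℝ (Fin m))
    (t : ℝ) (q : EuclideanSpace ℝ (Fin m)) (h : ℝ) : EuclideanSpace ℝ (Fin m) :=
  q + h • ∑ j, M.b j • M.stage R t q h j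

/-- The space spanned by the stage derivatives. -/
noncomputable def stageSpan (M : ExplicitRK s)
    (R : ℝ → EuclideanSpace ℝ (Fin m) → EuclideanSpace ℝ (Fin m))
    (t : ℝ) (q : EuclideanSpace ℝ (Fin m)) (h : ℝ) :
    Submodule ℝ (EuclideanSpace ℝ (Fin m)) :=
  Submodule.span ℝ (Set.range (M.stage R t q h))

/-- `∇G_s`: the orthogonal projection of `∇G (q^{n+1})` onto the span of the stage derivatives. -/
noncomputable def gradS (M : ExplicitRK s)
    (R : ℝ → EuclideanSpace ℝ (Fin m) → EuclideanSpace ℝ (Fin m))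
    (G : EuclideanSpace ℝ (Fin m) → ℝ)
    (t : ℝ) (q : EuclideanSpace ℝ (Fin m)) (h : ℝ) : EuclideanSpace ℝ (Fin m) :=
  (M.stageSpan R t q h).starProjection (gradient G (M.step R t q h))

/-- The quasi-orthogonally projected solution `q^{n+1} + μ ∇G_s / ‖∇G_s‖` with parameter `μ`. -/
noncomputable def qoStep (M : ExplicitRK s)
    (R : ℝ → EuclideanSpace ℝ (Fin m) → EuclideanSpace ℝ (Fin m))
    (G : EuclideanSpace ℝ (Fin m) → ℝ)
    (t : ℝ) (q : EuclideanSpace ℝ (Fin m)) (h μ : ℝ) : EuclideanSpace ℝ (Fin m) :=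
  M.step R t q h + μ • (‖M.gradS R G t q h‖⁻¹ • M.gradS R G t q h)

end ExplicitRK

/-- `y` solves `y' = R (t, y)` near `t₀` with `y t₀ = q₀`. -/
def IsLocalSolution {m : ℕ} (R : ℝ → EuclideanSpace ℝ (Fin m) → EuclideanSpace ℝ (Fin m))
    (t₀ : ℝ) (q₀ : EuclideanSpace ℝ (Fin m)) (y : ℝ → EuclideanSpace ℝ (Fin m)) : Prop :=
  y t₀ = q₀ ∧ ∀ᶠ t in 𝓝 t₀, HasDerivAt y (R t (y t)) t

/-- The method has order of accuracy (at least) `p`: for every smooth initial value problem, in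
every dimension, the error of one step of size `h` is `O(h ^ (p + 1))` as `h → 0+`. -/
def ExplicitRK.HasOrder {s : ℕ} (M : ExplicitRK s) (p : ℕ) : Prop :=
  ∀ (m : ℕ) (R : ℝ → EuclideanSpace ℝ (Fin m) → EuclideanSpace ℝ (Fin m)),
    ContDiff ℝ ∞ (Function.uncurry R) →
    ∀ (t₀ : ℝ) (q₀ : EuclideanSpace ℝ (Fin m)) (y : ℝ → EuclideanSpace ℝ (Fin m)),
      IsLocalSolution R t₀ q₀ y →
      (fun h : ℝ => M.step R t₀ q₀ h - y (t₀ + h)) =O[𝓝[>] 0] fun h : ℝ => h ^ (p + 1)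

/-- `G` is an invariant of `q' = R (t, q)` on the time interval `[0, T]`. -/
def IsInvariantOf {m : ℕ} (R : ℝ → EuclideanSpace ℝ (Fin m) → EuclideanSpace ℝ (Fin m))
    (G : EuclideanSpace ℝ (Fin m) → ℝ) (T : ℝ) : Prop :=
  ∀ t ∈ Set.Icc 0 T, ∀ q, inner ℝ (gradient G q) (R t q) = 0

/-! Write u = q^{n+1} - q^n and σ = ‖∇G_s‖. Along the unit vector ∇G_s/σ the slope of G at q^{n+1}
is exactly σ. Since u lies in the stage span, the relaxation condition forces σ ≥ |c|Δt/2
(`le_norm_gradS_of_relaxation`), so the slope stays above σ/2 for |λ| ≤ δΔt. Solvability and order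
then follow from a scalar root argument once the defect satisfies G(q^{n+1}) - G(q^n) = O(Δt^{p+1}
σ) (`exists_qoStep_of_isBigO`). As σ is so far only known to dominate Δt, the obvious defect
O(Δt^{p+1}) is not enough.

The missing factor σ comes from the order at which τ ↦ R(t_n+τ, q^n) vanishes at 0. If R(t_n, q^n) ≠
0, then σ is bounded away from 0: the difference of two stages is O(Δt), yet its component along
∇G(q^{n+1}) has exact order Δt (`exists_le_norm_gradS`). If the leading term is τ^k r with 1 ≤ k <
p, then u has size at least Δt^{k+1}, while its component along the gradient is o(Δt^{k+2}); this
contradicts c ≠ 0 (`isLittleO_inner_gradient_step_sub`, `eq_zero_of_relaxation`). If the field is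
O(τ^p), then u itself is O(Δt^{p+1}), and expanding G bounds the defect by σ‖u‖ + O(‖u‖²)
(`isBigO_defect_of_isBigO_step_sub`). -/

/-! ### One-variable Taylor estimates and a quantitative scalar root lemma. -/

section Calculus

variable {E F : Type*} [NormedAddCommGroup E] [NormedSpace ℝ E]
  [NormedAddCommGroup F] [NormedSpace ℝ F]

theorem isBigO_pow_pow_of_le {k n : ℕ} (hkn : k ≤ n) :
    (fun t : ℝ => t ^ n) =O[𝓝 0] fun t : ℝ => t ^ k := by
  rcases hkn.eq_or_lt with rfl | h
  · exact isBigO_refl _ _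
  · exact (isLittleO_pow_pow h).isBigO

/-- A function vanishing at `0` whose derivative is `O (t ^ k)` is `O (t ^ (k + 1))`. -/
theorem isBigO_pow_succ_of_hasDerivAt {f f' : ℝ → E} {k : ℕ} (h0 : f 0 = 0)
    (hf : ∀ᶠ t in 𝓝 (0 : ℝ), HasDerivAt f (f' t) t)
    (hf' : f' =O[𝓝 0] fun t : ℝ => t ^ k) :
    f =O[𝓝 0] fun t : ℝ => t ^ (k + 1) := by
  obtain ⟨C, hC⟩ := hf'.bound
  obtain ⟨ε, hε, hball⟩ := Metric.eventually_nhds_iff.1 (hf.and hC)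
  refine IsBigO.of_bound C (Metric.eventually_nhds_iff.2 ⟨ε, hε, fun t ht => ?_⟩)
  rw [Real.dist_0_eq_abs] at ht
  have hsub : ∀ x ∈ Metric.closedBall (0 : ℝ) |t|, |x| ≤ |t| := fun x hx => by
    simpa using hx
  have hC0 : 0 ≤ C * |t| ^ k := by
    have := (hball (y := t) (by simpa using ht)).2
    rw [norm_pow, Real.norm_eq_abs] at this
    exact (norm_nonneg _).trans this
  have key := (convex_closedBall (0 : ℝ) |t|).norm_image_sub_le_of_norm_hasDerivWithin_le
    (f := f) (f' := f') (C := C * |t| ^ k) (x := 0) (y := t)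
    (fun x hx => (hball (by simpa using (hsub x hx).trans_lt ht)).1.hasDerivWithinAt)
    (fun x hx => by
      have hx' := hsub x hx
      have hb := (hball (y := x) (by simpa using hx'.trans_lt ht)).2
      rw [norm_pow, Real.norm_eq_abs] at hb
      -- The constant from `bound` carries no sign; a negative one is compatible only with `|x| ^ k
      -- = 0`.
      rcases le_or_gt 0 C with h | h
      · exact hb.trans (by gcongr)
      · rcases eq_or_ne (|x| ^ k) 0 with h1 | h1
        · rw [h1, mul_zero] at hb
          exact hb.trans hC0
        · have h2 : 0 < |x| ^ k := lt_of_le_of_ne (by positivity) h1.symm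
          exact absurd ((norm_nonneg _).trans hb) (not_le.2 (mul_neg_of_neg_of_pos h h2)))
    (by simp) (by simp)
  rw [h0, sub_zero, sub_zero] at key
  calc ‖f t‖ ≤ C * |t| ^ k * ‖t‖ := key
    _ = C * ‖t ^ (k + 1)‖ := by rw [norm_pow, Real.norm_eq_abs, pow_succ, mul_assoc]

/-- A smooth function of one variable that vanishes to the right of `0` is flat at `0`. -/
theorem isBigO_pow_of_eventually_zero_right (N : ℕ) :
    ∀ {f : ℝ → E}, ContDiff ℝ ∞ f → (∀ᶠ t in 𝓝[>] (0 : ℝ), f t = 0) →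
      f =O[𝓝 0] fun t : ℝ => t ^ N := by
  induction N with
  | zero =>
    intro f hf _
    simpa using hf.continuous.continuousAt.norm.isBoundedUnder_le.isBigO_one ℝ
  | succ N ih =>
    intro f hf h
    have h0 : f 0 = 0 := by
      have h1 : Tendsto f (𝓝[>] 0) (𝓝 (f 0)) :=
        hf.continuous.continuousAt.tendsto.mono_left nhdsWithin_le_nhds
      exact tendsto_nhds_unique h1 (tendsto_const_nhds.congr' (h.mono fun t ht => ht.symm))
    -- Vanishing on an open interval passes to the derivative. Smoothness at `0` then turns the
    -- one-sided hypothesis into a two-sided bound, one power per integration.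
    have hd : ∀ᶠ t in 𝓝[>] (0 : ℝ), deriv f t = 0 := by
      obtain ⟨u, hu, hsub⟩ := mem_nhdsGT_iff_exists_Ioo_subset.1 h
      filter_upwards [Ioo_mem_nhdsGT hu] with t ht
      have : f =ᶠ[𝓝 t] fun _ => 0 := by
        filter_upwards [isOpen_Ioo.mem_nhds ht] with x hx using hsub hx
      rw [this.deriv_eq, deriv_const]
    exact isBigO_pow_succ_of_hasDerivAt h0
      (Eventually.of_forall fun t => (hf.differentiable (by simp) t).hasDerivAt)
      (ih (contDiff_infty_iff_deriv.1 hf).2 hd)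

/-- A smooth function of one variable is `O (t ^ n)` or has a leading Taylor term of order
`k < n` at `0`. -/
theorem isBigO_pow_or_exists_leading_term (n : ℕ) :
    ∀ {f : ℝ → E}, ContDiff ℝ ∞ f →
      (f =O[𝓝 0] fun t : ℝ => t ^ n) ∨
        ∃ k < n, ∃ r : E, r ≠ 0 ∧ (fun t => f t - t ^ k • r) =O[𝓝 0] fun t : ℝ => t ^ (k + 1) := by
  induction n with
  | zero =>
    intro f hf
    left
    simpa using hf.continuous.continuousAt.norm.isBoundedUnder_le.isBigO_one ℝ
  | succ n ih =>
    intro f hf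
    have hfd : ∀ t, HasDerivAt f (deriv f t) t :=
      fun t => (hf.differentiable (by simp) t).hasDerivAt
    have hf' : ContDiff ℝ ∞ (deriv f) := (contDiff_infty_iff_deriv.1 hf).2
    by_cases h0 : f 0 = 0
    · rcases ih hf' with h | ⟨k, hk, r, hr, h⟩
      · exact Or.inl (isBigO_pow_succ_of_hasDerivAt h0 (Eventually.of_forall hfd) h)
      · have hk0 : ((k : ℝ) + 1) ≠ 0 := by positivity
        refine Or.inr ⟨k + 1, by omega, ((k : ℝ) + 1)⁻¹ • r, smul_ne_zero (inv_ne_zero hk0) hr, ?_⟩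
        refine isBigO_pow_succ_of_hasDerivAt (f' := fun t => deriv f t - t ^ k • r) (by simp [h0])
          (Eventually.of_forall fun t => ?_) h
        have h1 := (hasDerivAt_pow (k + 1) t).smul_const (((k : ℝ) + 1)⁻¹ • r)
        refine (hfd t).sub (h1.congr_deriv ?_)
        rw [smul_smul]
        congr 1
        push_cast
        field_simp
    · refine Or.inr ⟨0, by omega, f 0, h0, ?_⟩
      simpa using (hfd 0).isBigO_sub

/-- First-order expansion of a `C²` function between two nearby points, with the derivative
frozen at a third one. -/
theorem ContDiff.isBigO_sub_sub_fderiv {f : E → F} (hf : ContDiff ℝ ∞ f) (p : E) :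
    (fun x : E × E => f x.1 - f x.2 - fderiv ℝ f p (x.1 - x.2)) =O[𝓝 (p, p)]
      fun x => (‖x.1 - p‖ + ‖x.2 - p‖) * ‖x.1 - x.2‖ := by
  have hd : ContDiff ℝ ∞ (fderiv ℝ f) := hf.fderiv_right (by simp)
  obtain ⟨C, hC⟩ := (hd.differentiable (by simp) p).isBigO_sub.bound
  obtain ⟨ε, hε, hball⟩ := Metric.eventually_nhds_iff.1 hC
  refine IsBigO.of_bound |C| (Metric.eventually_nhds_iff.2 ⟨ε, hε, fun x hx => ?_⟩)
  rw [Prod.dist_eq, max_lt_iff, dist_eq_norm, dist_eq_norm] at hx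
  set ρ := ‖x.1 - p‖ + ‖x.2 - p‖ with hρ
  set μ := max ‖x.1 - p‖ ‖x.2 - p‖ with hμ
  have hμρ : μ ≤ ρ := max_le (by simp [hρ]) (by simp [hρ])
  have key := (convex_closedBall p μ).norm_image_sub_le_of_norm_fderiv_le' (𝕜 := ℝ)
    (f := f) (C := |C| * μ) (φ := fderiv ℝ f p) (x := x.2) (y := x.1)
    (fun z _ => hf.differentiable (by simp) z)
    (fun z hz => by
      have hz' : ‖z - p‖ ≤ μ := by simpa [dist_eq_norm] using hz
      have h1 := hball (y := z) (by rw [dist_eq_norm]; exact hz'.trans_lt (max_lt hx.1 hx.2))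
      exact h1.trans (mul_le_mul (le_abs_self C) hz' (norm_nonneg _) (abs_nonneg _)))
    (by simp [dist_eq_norm, hμ]) (by simp [dist_eq_norm, hμ])
  rw [Real.norm_of_nonneg (by positivity : 0 ≤ ρ * ‖x.1 - x.2‖)]
  calc _ ≤ |C| * μ * ‖x.1 - x.2‖ := key
    _ ≤ |C| * ρ * ‖x.1 - x.2‖ := by gcongr
    _ = _ := by ring

/-- A scalar function with derivative at least `σ > 0` on `[-d, d]` takes every value close to
`f 0` exactly once there. -/
theorem exists_unique_root_of_le_deriv {f f' : ℝ → ℝ} {d σ a : ℝ} (hd : 0 ≤ d) (hσ : 0 < σ)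
    (hf : ∀ x, |x| ≤ d → HasDerivAt f (f' x) x) (hf' : ∀ x, |x| ≤ d → σ ≤ f' x)
    (ha : |f 0 - a| ≤ σ * d) :
    ∃ μ, |μ| ≤ d ∧ f μ = a ∧ (∀ ν, |ν| ≤ d → f ν = a → ν = μ) ∧ σ * |μ| ≤ |f 0 - a| := by
  have hmem : ∀ x, x ∈ Set.Icc (-d) d → |x| ≤ d := fun x hx => abs_le.2 hx
  have hcont : ContinuousOn f (Set.Icc (-d) d) :=
    fun x hx => (hf x (hmem x hx)).continuousAt.continuousWithinAt
  have hgrow : ∀ x ∈ Set.Icc (-d) d, ∀ y ∈ Set.Icc (-d) d, x ≤ y → σ * (y - x) ≤ f y - f x :=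
    (convex_Icc (-d) d).mul_sub_le_image_sub_of_le_deriv hcont
      (fun x hx => (hf x (hmem x (interior_subset hx))).differentiableAt.differentiableWithinAt)
      (fun x hx => by
        rw [(hf x (hmem x (interior_subset hx))).deriv]
        exact hf' x (hmem x (interior_subset hx)))
  have h0 : (0 : ℝ) ∈ Set.Icc (-d) d := ⟨by linarith, hd⟩
  have hl : -d ∈ Set.Icc (-d) d := ⟨le_rfl, by linarith⟩
  have hr : d ∈ Set.Icc (-d) d := ⟨by linarith, le_rfl⟩
  have h1 := hgrow _ hl _ h0 (by linarith)
  have h2 := hgrow _ h0 _ hr hd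
  rw [abs_le] at ha
  obtain ⟨μ, hμ, hfμ⟩ := intermediate_value_Icc (by linarith : -d ≤ d) hcont
    (show a ∈ Set.Icc (f (-d)) (f d) from ⟨by linarith, by linarith⟩)
  refine ⟨μ, hmem μ hμ, hfμ, fun ν hν hfν => ?_, ?_⟩
  · have hν' : ν ∈ Set.Icc (-d) d := abs_le.1 hν
    rcases le_total ν μ with h | h
    · have := hgrow _ hν' _ hμ h
      rw [hfμ, hfν, sub_self] at this
      have := nonpos_of_mul_nonpos_right this hσ
      linarith
    · have := hgrow _ hμ _ hν' h
      rw [hfμ, hfν, sub_self] at this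
      have := nonpos_of_mul_nonpos_right this hσ
      linarith
  · rcases le_total 0 μ with h | h
    · have := hgrow _ h0 _ hμ h
      rw [abs_of_nonneg h, abs_sub_comm, ← hfμ]
      exact le_trans (by linarith) (le_abs_self _)
    · have := hgrow _ hμ _ h0 h
      rw [abs_of_nonpos h, ← hfμ]
      exact le_trans (by linarith) (le_abs_self _)

end Calculus

/-! ### Stages as smooth functions of the step size; geometry of the stage span. -/

section Preliminaries

variable {s m : ℕ} {R : ℝ → EuclideanSpace ℝ (Fin m) → EuclideanSpace ℝ (Fin m)}
  {G : EuclideanSpace ℝ (Fin m) → ℝ} {t : ℝ} {q : EuclideanSpace ℝ (Fin m)}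

theorem contDiff_gradient (hG : ContDiff ℝ ∞ G) : ContDiff ℝ ∞ (gradient G) :=
  (InnerProductSpace.toDual ℝ (EuclideanSpace ℝ (Fin m))).symm.toContinuousLinearEquiv.contDiff.comp
    (hG.fderiv_right (by simp))

/-- A smooth vector field is locally Lipschitz in the state, along any filter. -/
theorem isBigO_field_sub (hR : ContDiff ℝ ∞ (Function.uncurry R)) {ι : Type*} {l : Filter ι}
    {τ : ι → ℝ} {x x' : ι → EuclideanSpace ℝ (Fin m)} (hτ : Tendsto τ l (𝓝 t))
    (hx : Tendsto x l (𝓝 q)) (hx' : Tendsto x' l (𝓝 q)) :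
    (fun i => R (τ i) (x i) - R (τ i) (x' i)) =O[l] fun i => x i - x' i := by
  have h1 := (hR.contDiffAt (x := (t, q))).hasStrictFDerivAt (by simp) |>.isBigO_sub
  have h2 : Tendsto (fun i => ((τ i, x i), (τ i, x' i))) l (𝓝 ((t, q), (t, q))) :=
    (hτ.prodMk_nhds hx).prodMk_nhds (hτ.prodMk_nhds hx')
  refine (h1.comp_tendsto h2).trans (IsBigO.of_bound 1 (Eventually.of_forall fun i => ?_))
  simp

namespace ExplicitRK

variable (M : ExplicitRK s)

theorem step_sub (h : ℝ) : M.step R t q h - q = h • ∑ j, M.b j • M.stage R t q h j := by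
  simp [step]

theorem stage_zero (i : Fin s) : M.stage R t q 0 i = R t q := by
  rw [stage_eq]; simp

theorem step_zero : M.step R t q 0 = q := by simp [step]

/-- The recursion for the stages, with the sum over the previous stages only. -/
theorem stage_eq_sum_lt (h : ℝ) (i : Fin s) :
    M.stage R t q h i = R (t + M.c i * h)
      (q + h • ∑ j ∈ Finset.univ.filter (· < i), M.a i j • M.stage R t q h j) := by
  rw [stage_eq, Finset.sum_filter_of_ne]
  intro j _ hj
  by_contra hij
  exact hj (by rw [M.explicit i j (not_lt.1 hij), zero_smul])

theorem contDiff_stage (hR : ContDiff ℝ ∞ (Function.uncurry R)) (i : Fin s) :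
    ContDiff ℝ ∞ fun h => M.stage R t q h i := by
  induction i using WellFoundedLT.induction with
  | ind i ih =>
    have h1 : ContDiff ℝ ∞ fun h : ℝ => (t + M.c i * h,
        q + h • ∑ j ∈ Finset.univ.filter (· < i), M.a i j • M.stage R t q h j) := by
      refine ContDiff.prodMk (by fun_prop) (contDiff_const.add (contDiff_id.smul ?_))
      exact ContDiff.sum fun j hj => (ih j (Finset.mem_filter.1 hj).2).const_smul _
    simp_rw [M.stage_eq_sum_lt _ i]
    exact hR.comp h1

theorem contDiff_step (hR : ContDiff ℝ ∞ (Function.uncurry R)) :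
    ContDiff ℝ ∞ fun h => M.step R t q h :=
  contDiff_const.add (contDiff_id.smul
    (ContDiff.sum fun j _ => (M.contDiff_stage hR j).const_smul _))

theorem tendsto_step (hR : ContDiff ℝ ∞ (Function.uncurry R)) :
    Tendsto (M.step R t q) (𝓝 0) (𝓝 q) := by
  have := (M.contDiff_step (t := t) (q := q) hR).continuous.tendsto 0
  rwa [step_zero] at this

theorem hasDerivAt_smul_sum_stage (hR : ContDiff ℝ ∞ (Function.uncurry R)) (w : Fin s → ℝ) :
    HasDerivAt (fun h : ℝ => h • ∑ j, w j • M.stage R t q h j) ((∑ j, w j) • R t q) 0 := by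
  have h1 : ContDiff ℝ ∞ fun h : ℝ => ∑ j, w j • M.stage R t q h j :=
    ContDiff.sum fun j _ => (M.contDiff_stage hR j).const_smul _
  have h2 := (hasDerivAt_id (0 : ℝ)).smul (h1.differentiable (by simp) 0).hasDerivAt
  refine h2.congr_deriv ?_
  simp [stage_zero, Finset.sum_smul]

theorem hasDerivAt_stage (hR : ContDiff ℝ ∞ (Function.uncurry R)) (i : Fin s) :
    HasDerivAt (fun h => M.stage R t q h i)
      (fderiv ℝ (Function.uncurry R) (t, q) (M.c i, M.c i • R t q)) 0 := by
  have h1 : HasDerivAt (fun h : ℝ => (t + M.c i * h, q + h • ∑ j, M.a i j • M.stage R t q h j))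
      (M.c i, M.c i • R t q) 0 := by
    refine HasDerivAt.prodMk ?_ ?_
    · simpa using ((hasDerivAt_id (0 : ℝ)).const_mul (M.c i)).const_add t
    · exact (M.hasDerivAt_smul_sum_stage hR (M.a i)).const_add q
  have h2 : HasFDerivAt (Function.uncurry R) (fderiv ℝ (Function.uncurry R) (t, q))
      (t + M.c i * 0, q + (0 : ℝ) • ∑ j, M.a i j • M.stage R t q 0 j) := by
    simpa using (hR.differentiable (by simp) (t, q)).hasFDerivAt
  refine (h2.comp_hasDerivAt (0 : ℝ) h1).congr_of_eventuallyEq (Eventually.of_forall fun h => ?_)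
  exact M.stage_eq R t q h i

theorem tendsto_smul_sum_stage (hR : ContDiff ℝ ∞ (Function.uncurry R)) (w : Fin s → ℝ) :
    Tendsto (fun h : ℝ => q + h • ∑ j, w j • M.stage R t q h j) (𝓝 0) (𝓝 q) := by
  have := ((M.hasDerivAt_smul_sum_stage (t := t) (q := q) hR w).continuousAt.tendsto).const_add q
  simpa using this

theorem tendsto_time (a : ℝ) : Tendsto (fun h : ℝ => t + a * h) (𝓝 0) (𝓝 t) := by
  have : Continuous fun h : ℝ => t + a * h := by fun_prop
  simpa using this.tendsto 0

/-- The stages are `O (h ^ k)` if the field is, in time, at the initial point. -/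
theorem isBigO_stage (hR : ContDiff ℝ ∞ (Function.uncurry R)) {k : ℕ}
    (hρ : (fun τ => R (t + τ) q) =O[𝓝 0] fun τ : ℝ => τ ^ k) (i : Fin s) :
    (fun h => M.stage R t q h i) =O[𝓝 0] fun h : ℝ => h ^ k := by
  induction i using WellFoundedLT.induction with
  | ind i ih =>
    have h1 : (fun h : ℝ => h • ∑ j ∈ Finset.univ.filter (· < i), M.a i j • M.stage R t q h j)
        =O[𝓝 0] fun h : ℝ => h ^ k := by
      have h2 : (fun h : ℝ => ∑ j ∈ Finset.univ.filter (· < i), M.a i j • M.stage R t q h j)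
          =O[𝓝 0] fun h : ℝ => h ^ k :=
        IsBigO.fun_sum fun j hj => (ih j (Finset.mem_filter.1 hj).2).const_smul_left (M.a i j)
      have h3 : (fun h : ℝ => h) =O[𝓝 0] fun _ => (1 : ℝ) :=
        continuous_id.continuousAt.norm.isBoundedUnder_le.isBigO_one ℝ
      simpa using h3.smul h2
    have h4 : (fun h : ℝ => R (t + M.c i * h) q) =O[𝓝 0] fun h : ℝ => h ^ k := by
      have h5 : Tendsto (fun h : ℝ => M.c i * h) (𝓝 0) (𝓝 0) := by
        simpa using tendsto_time (t := 0) (M.c i)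
      refine (hρ.comp_tendsto h5).trans (IsBigO.of_bound (|M.c i| ^ k)
        (Eventually.of_forall fun h => ?_))
      simp [mul_pow]
    have h6 : Tendsto (fun h : ℝ =>
        q + h • ∑ j ∈ Finset.univ.filter (· < i), M.a i j • M.stage R t q h j) (𝓝 0) (𝓝 q) := by
      refine (M.tendsto_smul_sum_stage (t := t) hR (M.a i)).congr fun h => ?_
      rw [Finset.sum_filter_of_ne]
      intro j _ hj
      by_contra hij
      exact hj (by rw [M.explicit i j (not_lt.1 hij), zero_smul])
    have h7 := (isBigO_field_sub hR (tendsto_time (t := t) (M.c i)) h6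
      (tendsto_const_nhds (x := q))).trans (by simpa using h1)
    refine (h7.add h4).congr_left fun h => ?_
    rw [sub_add_cancel, M.stage_eq_sum_lt h i]

theorem stage_mem_stageSpan (h : ℝ) (i : Fin s) : M.stage R t q h i ∈ M.stageSpan R t q h :=
  Submodule.subset_span ⟨i, rfl⟩

theorem step_sub_mem_stageSpan (h : ℝ) : M.step R t q h - q ∈ M.stageSpan R t q h := by
  rw [step_sub]
  exact Submodule.smul_mem _ _ (Submodule.sum_mem _ fun j _ =>
    Submodule.smul_mem _ _ (M.stage_mem_stageSpan h j))

/-- The projection is self-adjoint and fixes `w`. Every lower bound on `‖∇G_s‖` comes from testing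
with a suitable `w`: the increment, or a difference of stages. -/
theorem abs_inner_gradient_le (h : ℝ) {w : EuclideanSpace ℝ (Fin m)}
    (hw : w ∈ M.stageSpan R t q h) :
    |inner ℝ (gradient G (M.step R t q h)) w| ≤ ‖M.gradS R G t q h‖ * ‖w‖ := by
  have h1 : inner ℝ (gradient G (M.step R t q h)) w = inner ℝ (M.gradS R G t q h) w := by
    rw [gradS, Submodule.inner_starProjection_left_eq_right,
      Submodule.starProjection_eq_self_iff.2 hw]
  rw [h1]
  exact abs_real_inner_le_norm _ _

theorem inner_gradient_gradS (h : ℝ) :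
    inner ℝ (gradient G (M.step R t q h)) (M.gradS R G t q h) = ‖M.gradS R G t q h‖ ^ 2 := by
  have hw : M.gradS R G t q h ∈ M.stageSpan R t q h := Submodule.starProjection_apply_mem _ _
  rw [← real_inner_self_eq_norm_sq]
  nth_rw 2 [gradS]
  rw [Submodule.inner_starProjection_left_eq_right, Submodule.starProjection_eq_self_iff.2 hw]

end ExplicitRK

/-! ### Short-time expansion of the exact solution. -/

section Solution

variable {y : ℝ → EuclideanSpace ℝ (Fin m)}

theorem IsLocalSolution.eventually_hasDerivAt (hy : IsLocalSolution R t q y) :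
    ∀ᶠ h in 𝓝 (0 : ℝ), HasDerivAt (fun h => y (t + h)) (R (t + h) (y (t + h))) h := by
  have h1 : Tendsto (fun h : ℝ => t + h) (𝓝 0) (𝓝 t) := by
    simpa using ExplicitRK.tendsto_time (t := t) 1
  filter_upwards [h1.eventually hy.2] with h hh
  exact hh.comp_const_add t h

theorem IsLocalSolution.tendsto (hy : IsLocalSolution R t q y) :
    Tendsto (fun h => y (t + h)) (𝓝 0) (𝓝 q) := by
  have := hy.eventually_hasDerivAt.self_of_nhds.continuousAt.tendsto
  simpa [hy.1] using this

theorem IsLocalSolution.isBigO_field_sub (hR : ContDiff ℝ ∞ (Function.uncurry R))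
    (hy : IsLocalSolution R t q y) :
    (fun h => R (t + h) (y (t + h)) - R (t + h) q) =O[𝓝 0] fun h => y (t + h) - q :=
  _root_.isBigO_field_sub hR (by simpa using ExplicitRK.tendsto_time (t := t) 1) hy.tendsto
    tendsto_const_nhds

/-- Bootstrap: by the Lipschitz bound, a rate `h ^ j` for `y - q` bounds the derivative by the same
rate plus the forcing `h ^ k`, and integration gains one power until the forcing dominates. -/
theorem IsLocalSolution.isBigO_sub (hR : ContDiff ℝ ∞ (Function.uncurry R))
    (hy : IsLocalSolution R t q y) {k : ℕ}
    (hρ : (fun τ => R (t + τ) q) =O[𝓝 0] fun τ : ℝ => τ ^ k) :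
    (fun h => y (t + h) - q) =O[𝓝 0] fun h : ℝ => h ^ (k + 1) := by
  have key : ∀ j ≤ k + 1, (fun h => y (t + h) - q) =O[𝓝 0] fun h : ℝ => h ^ j := by
    intro j
    induction j with
    | zero =>
      intro _
      simpa using (hy.tendsto.sub_const q).norm.isBoundedUnder_le.isBigO_one ℝ
    | succ j ih =>
      intro hj
      refine isBigO_pow_succ_of_hasDerivAt (by simp [hy.1])
        (hy.eventually_hasDerivAt.mono fun h hh => hh.sub_const q) ?_
      have h1 := (hy.isBigO_field_sub hR).trans (ih (by omega))
      exact (h1.add (hρ.trans (isBigO_pow_pow_of_le (by omega)))).congr_left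
        fun h => sub_add_cancel _ _
  exact key _ le_rfl

/-- The motion of `y` changes the field only by `O (h ^ (k + 1))`, so the leading term of `y - q` is
the integral of `τ ^ k • r`. -/
theorem IsLocalSolution.isBigO_sub_leading (hR : ContDiff ℝ ∞ (Function.uncurry R))
    (hy : IsLocalSolution R t q y) {k : ℕ} {r : EuclideanSpace ℝ (Fin m)}
    (hρ : (fun τ => R (t + τ) q - τ ^ k • r) =O[𝓝 0] fun τ : ℝ => τ ^ (k + 1)) :
    (fun h => y (t + h) - q - (h ^ (k + 1) / (k + 1)) • r) =O[𝓝 0] fun h : ℝ => h ^ (k + 2) := by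
  have hk0 : ((k : ℝ) + 1) ≠ 0 := by positivity
  have h1 : (fun τ : ℝ => τ ^ k • r) =O[𝓝 0] fun τ : ℝ => τ ^ k := by
    simpa using (isBigO_refl (fun τ : ℝ => τ ^ k) (𝓝 0)).smul
      (isBigO_refl (fun _ => r) (𝓝 0) |>.trans (isBigO_const_const r (one_ne_zero (α := ℝ)) _))
  have h2 : (fun τ => R (t + τ) q) =O[𝓝 0] fun τ : ℝ => τ ^ k :=
    ((hρ.trans (isBigO_pow_pow_of_le (by omega))).add h1).congr_left fun τ => sub_add_cancel _ _
  have h3 := (hy.isBigO_field_sub hR).trans (hy.isBigO_sub hR h2)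
  refine isBigO_pow_succ_of_hasDerivAt (f' := fun h => R (t + h) (y (t + h)) - h ^ k • r)
    (by simp [hy.1]) (hy.eventually_hasDerivAt.mono fun h hh => ?_)
    ((h3.add hρ).congr_left fun h => by abel)
  have h4 := (((hasDerivAt_pow (k + 1) h).div_const ((k : ℝ) + 1)).smul_const r)
  refine (hh.sub_const q).sub (h4.congr_deriv ?_)
  congr 1
  push_cast
  field_simp

end Solution

end Preliminaries

/-! ### Consequences of the invariance identity. -/

section Invariant

variable {s m : ℕ} {R : ℝ → EuclideanSpace ℝ (Fin m) → EuclideanSpace ℝ (Fin m)}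
  {G : EuclideanSpace ℝ (Fin m) → ℝ} {T t : ℝ} {q : EuclideanSpace ℝ (Fin m)}
  {y : ℝ → EuclideanSpace ℝ (Fin m)}

theorem IsInvariantOf.eventually_inner_eq_zero (hinv : IsInvariantOf R G T)
    (ht : t ∈ Set.Ico 0 T) :
    ∀ᶠ τ in 𝓝[>] (0 : ℝ), ∀ q, inner ℝ (gradient G q) (R (t + τ) q) = 0 := by
  filter_upwards [Ioo_mem_nhdsGT (sub_pos.2 ht.2)] with τ hτ q
  exact hinv _ ⟨by linarith [ht.1, hτ.1], by linarith [hτ.2]⟩ q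

theorem contDiff_inner_field (hR : ContDiff ℝ ∞ (Function.uncurry R))
    (v : EuclideanSpace ℝ (Fin m)) :
    ContDiff ℝ ∞ fun p : ℝ × EuclideanSpace ℝ (Fin m) => inner ℝ v (Function.uncurry R p) :=
  contDiff_const.inner ℝ hR

/-- The component of the field along the gradient is flat in time at the initial point. -/
theorem IsInvariantOf.isBigO_inner (hinv : IsInvariantOf R G T) (ht : t ∈ Set.Ico 0 T)
    (hR : ContDiff ℝ ∞ (Function.uncurry R)) (N : ℕ) :
    (fun τ => inner ℝ (gradient G q) (R (t + τ) q)) =O[𝓝 0] fun τ : ℝ => τ ^ N := by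
  refine isBigO_pow_of_eventually_zero_right N ?_
    ((hinv.eventually_inner_eq_zero ht).mono fun τ h => h q)
  exact (contDiff_inner_field hR (gradient G q)).comp
    (f := fun τ : ℝ => (t + τ, q)) (by fun_prop)

/-- Flatness supplies the two-sided derivative, which invariance alone would not give at `t = 0`. -/
theorem IsInvariantOf.inner_fderiv_time (hinv : IsInvariantOf R G T) (ht : t ∈ Set.Ico 0 T)
    (hR : ContDiff ℝ ∞ (Function.uncurry R)) :
    inner ℝ (gradient G q) (fderiv ℝ (Function.uncurry R) (t, q) (1, 0)) = 0 := by
  have h1 : HasDerivAt (fun τ : ℝ => (t + τ, q)) (1, 0) 0 :=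
    ((hasDerivAt_id (0 : ℝ)).const_add t).prodMk (hasDerivAt_const _ _)
  have h2 : HasFDerivAt (Function.uncurry R) (fderiv ℝ (Function.uncurry R) (t, q)) (t + 0, q) := by
    simpa using (hR.differentiable (by simp) (t, q)).hasFDerivAt
  have h3 := (hasDerivAt_const (0 : ℝ) (gradient G q)).inner ℝ (h2.comp_hasDerivAt (0 : ℝ) h1)
  have h4 : HasDerivAt (fun τ => inner ℝ (gradient G q) (R (t + τ) q)) 0 0 := by
    have h0 : inner ℝ (gradient G q) (R t q) = 0 := hinv t ⟨ht.1, ht.2.le⟩ q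
    rw [hasDerivAt_iff_isLittleO]
    simpa [h0] using (hinv.isBigO_inner ht hR 2).trans_isLittleO (isLittleO_pow_id (𝕜 := ℝ) one_lt_two)
  have h5 := h3.unique h4
  simpa using h5

/-- Product rule applied to the invariance identity, which holds for every state. -/
theorem IsInvariantOf.inner_fderiv_space (hinv : IsInvariantOf R G T) (ht : t ∈ Set.Ico 0 T)
    (hR : ContDiff ℝ ∞ (Function.uncurry R)) (hG : ContDiff ℝ ∞ G)
    (x : EuclideanSpace ℝ (Fin m)) :
    inner ℝ (gradient G q) (fderiv ℝ (Function.uncurry R) (t, q) (0, x)) +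
      inner ℝ (fderiv ℝ (gradient G) q x) (R t q) = 0 := by
  have h0 : HasDerivAt (fun a : ℝ => q + a • x) x 0 := by
    simpa using ((hasDerivAt_id (0 : ℝ)).smul_const x).const_add q
  have h1 : HasDerivAt (fun a : ℝ => (t, q + a • x)) (0, x) 0 := (hasDerivAt_const _ _).prodMk h0
  have h2 : HasFDerivAt (Function.uncurry R) (fderiv ℝ (Function.uncurry R) (t, q))
      (t, q + (0 : ℝ) • x) := by
    simpa using (hR.differentiable (by simp) (t, q)).hasFDerivAt
  have h3 : HasFDerivAt (gradient G) (fderiv ℝ (gradient G) q) (q + (0 : ℝ) • x) := by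
    simpa using ((contDiff_gradient hG).differentiable (by simp) q).hasFDerivAt
  have h4 := (h3.comp_hasDerivAt (0 : ℝ) h0).inner ℝ (h2.comp_hasDerivAt (0 : ℝ) h1)
  have h5 := h4.unique ((hasDerivAt_const (0 : ℝ) (0 : ℝ)).congr_of_eventuallyEq
    (Eventually.of_forall fun a => hinv t ⟨ht.1, ht.2.le⟩ (q + a • x)))
  simpa using h5

theorem IsInvariantOf.eventually_eq (hinv : IsInvariantOf R G T) (ht : t ∈ Set.Ico 0 T)
    (hG : ContDiff ℝ ∞ G) (hy : IsLocalSolution R t q y) :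
    ∀ᶠ h in 𝓝[>] (0 : ℝ), G (y (t + h)) = G q := by
  obtain ⟨ε, hε, hball⟩ := Metric.eventually_nhds_iff.1 hy.eventually_hasDerivAt
  filter_upwards [Ioo_mem_nhdsGT (lt_min hε (sub_pos.2 ht.2))] with h hh
  have hlt := lt_min_iff.1 hh.2
  have hd : ∀ x ∈ Set.Icc 0 h, HasDerivAt (fun h => G (y (t + h))) 0 x := by
    intro x hx
    have h1 := hball (y := x) (by
      rw [Real.dist_0_eq_abs, abs_of_nonneg hx.1]; exact hx.2.trans_lt hlt.1)
    have h2 := (hG.differentiable (by simp) (y (t + x))).hasFDerivAt.comp_hasDerivAt x h1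
    refine h2.congr_deriv ?_
    rw [← inner_gradient_left]
    exact hinv _ ⟨by linarith [ht.1, hx.1], by linarith [hx.2]⟩ _
  have := constant_of_has_deriv_right_zero
    (fun x hx => (hd x hx).continuousAt.continuousWithinAt)
    (fun x hx => (hd x ⟨hx.1, hx.2.le⟩).hasDerivWithinAt) h ⟨hh.1.le, le_rfl⟩
  simpa [hy.1] using this

namespace ExplicitRK

variable (M : ExplicitRK s)

/-- If the field vanishes at the initial point and is `O (τ ^ k)` in time there, then the stages
are orthogonal to the initial gradient up to `O (h ^ (k + 2))`. -/
theorem isBigO_inner_stage (hinv : IsInvariantOf R G T) (ht : t ∈ Set.Ico 0 T)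
    (hR : ContDiff ℝ ∞ (Function.uncurry R)) (hG : ContDiff ℝ ∞ G) {k : ℕ} (hR0 : R t q = 0)
    (hρ : (fun τ => R (t + τ) q) =O[𝓝 0] fun τ : ℝ => τ ^ k) (i : Fin s) :
    (fun h => inner ℝ (gradient G q) (M.stage R t q h i)) =O[𝓝 0] fun h : ℝ => h ^ (k + 2) := by
  set X : ℝ → EuclideanSpace ℝ (Fin m) := fun h => h • ∑ j, M.a i j • M.stage R t q h j with hX
  have hXk : X =O[𝓝 0] fun h : ℝ => h ^ (k + 1) := by
    have h1 : (fun h : ℝ => ∑ j, M.a i j • M.stage R t q h j) =O[𝓝 0] fun h : ℝ => h ^ k :=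
      IsBigO.fun_sum fun j _ => (M.isBigO_stage hR hρ j).const_smul_left (M.a i j)
    refine ((isBigO_refl (fun h : ℝ => h) (𝓝 0)).smul h1).congr_right fun h => ?_
    rw [smul_eq_mul, pow_succ']
  have hX0 : X =O[𝓝 0] fun h : ℝ => h := by
    simpa using hXk.trans (isBigO_pow_pow_of_le (show 1 ≤ k + 1 by omega))
  have hc : (fun h : ℝ => M.c i * h) =O[𝓝 0] fun h : ℝ => h :=
    (isBigO_refl (fun h : ℝ => h) (𝓝 0)).const_mul_left _
  have hc0 : Tendsto (fun h : ℝ => M.c i * h) (𝓝 0) (𝓝 0) := by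
    simpa using tendsto_time (t := 0) (M.c i)
  have hexp := (contDiff_inner_field hR (gradient G q)).isBigO_sub_sub_fderiv (t, q)
  have htend : Tendsto (fun h : ℝ => ((t + M.c i * h, q + X h), (t + M.c i * h, q))) (𝓝 0)
      (𝓝 ((t, q), (t, q))) :=
    ((tendsto_time (M.c i)).prodMk_nhds (M.tendsto_smul_sum_stage hR (M.a i))).prodMk_nhds
      ((tendsto_time (M.c i)).prodMk_nhds tendsto_const_nhds)
  have hexp' := hexp.comp_tendsto htend
  have hright : (fun h : ℝ => (‖(M.c i * h, X h)‖ + ‖(M.c i * h, (0 : EuclideanSpace ℝ (Fin m)))‖)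
      * ‖((0 : ℝ), X h)‖) =O[𝓝 0] fun h : ℝ => h ^ (k + 2) := by
    have h1 : (fun h : ℝ => (M.c i * h, X h)) =O[𝓝 0] fun h : ℝ => h := hc.prod_left hX0
    have h2 : (fun h : ℝ => (M.c i * h, (0 : EuclideanSpace ℝ (Fin m)))) =O[𝓝 0] fun h : ℝ => h :=
      hc.prod_left (isBigO_zero _ _)
    have h3 : (fun h : ℝ => ((0 : ℝ), X h)) =O[𝓝 0] fun h : ℝ => h ^ (k + 1) :=
      (isBigO_zero _ _).prod_left hXk
    exact ((h1.norm_left.add h2.norm_left).mul h3.norm_left).congr_right fun h => by ring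
  -- Here `R t q = 0` enters: it kills the Hessian term of the differentiated invariance identity,
  -- so the linear term in `X h` disappears.
  have hder : ∀ x, fderiv ℝ (fun p : ℝ × EuclideanSpace ℝ (Fin m) =>
      inner ℝ (gradient G q) (Function.uncurry R p)) (t, q) (0, x) = 0 := by
    intro x
    have h1 := hinv.inner_fderiv_space (q := q) ht hR hG x
    rw [hR0, inner_zero_right, add_zero] at h1
    rw [fderiv_inner_apply ℝ (differentiableAt_const _) (hR.differentiable (by simp) _)]
    simpa using h1
  -- An abscissa may be negative, so `t + c_i h` can leave `[0, T]`; two-sided flatness covers this.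
  have hflat : (fun h => inner ℝ (gradient G q) (R (t + M.c i * h) q))
      =O[𝓝 0] fun h : ℝ => h ^ (k + 2) :=
    ((hinv.isBigO_inner ht hR (k + 2)).comp_tendsto hc0).trans (by
      simpa [Function.comp_def] using hc.pow (k + 2))
  have hdiff : (fun h => inner ℝ (gradient G q) (R (t + M.c i * h) (q + X h)) -
      inner ℝ (gradient G q) (R (t + M.c i * h) q)) =O[𝓝 0] fun h : ℝ => h ^ (k + 2) := by
    refine (hexp'.congr (fun h => ?_) fun h => ?_).trans hright
    · simp only [Function.comp_apply, Prod.mk_sub_mk, sub_self, add_sub_cancel_left, hder, sub_zero,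
        Function.uncurry_apply_pair]
    · simp only [Function.comp_apply, Prod.mk_sub_mk, sub_self, add_sub_cancel_left]
  refine (hdiff.add hflat).congr_left fun h => ?_
  rw [sub_add_cancel, M.stage_eq _ _ _ h i]

end ExplicitRK

end Invariant

/-! ### Solvability from a defect bound, and the two uses of the relaxation condition. -/

section QuasiOrthogonal

variable {s m : ℕ} {R : ℝ → EuclideanSpace ℝ (Fin m) → EuclideanSpace ℝ (Fin m)}
  {G : EuclideanSpace ℝ (Fin m) → ℝ} {T t c : ℝ} {q : EuclideanSpace ℝ (Fin m)}
  {y : ℝ → EuclideanSpace ℝ (Fin m)} {p : ℕ}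

namespace ExplicitRK

/-- A method of order at least two has a nonzero abscissa. -/
theorem HasOrder.exists_c_ne_zero {M : ExplicitRK s} (hM : M.HasOrder p) (hp : 2 ≤ p) :
    ∃ i, M.c i ≠ 0 := by
  by_contra! hc
  -- Test problem `y' = τ e`: with all abscissae zero the method does not move, while the solution
  -- moves by `h ^ 2 / 2`.
  set e : EuclideanSpace ℝ (Fin 1) := EuclideanSpace.single 0 1 with he
  have he1 : ‖e‖ = 1 := by simp [he]
  have hsol : IsLocalSolution (fun τ _ => τ • e) 0 0 fun τ => (τ ^ 2 / 2) • e := by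
    refine ⟨by simp, Eventually.of_forall fun τ => ?_⟩
    exact (((hasDerivAt_pow 2 τ).div_const 2).smul_const e).congr_deriv (by simp)
  have h1 := hM 1 (fun τ _ => τ • e) (contDiff_fst.smul contDiff_const) 0 0 _ hsol
  have h2 : (fun h : ℝ => h ^ 2) =O[𝓝[>] 0] fun h : ℝ => h ^ (p + 1) := by
    refine (IsBigO.of_bound 2 (Eventually.of_forall fun h => ?_)).trans h1
    simp [step, stage_eq, hc, norm_smul, he1, mul_div_cancel₀]
  have h3 : (fun h : ℝ => h ^ (p + 1)) =o[𝓝[>] 0] fun h : ℝ => h ^ 2 :=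
    (isLittleO_pow_pow (by omega)).mono nhdsWithin_le_nhds
  refine isLittleO_irrefl ?_ (h2.trans_isLittleO h3)
  refine Eventually.frequently (eventually_mem_nhdsWithin.mono fun h hh => ?_)
  simpa using (ne_of_gt hh : h ≠ 0)

variable (M : ExplicitRK s)

/-- If the defect of the invariant is controlled by the size of the projected gradient, then the
quasi-orthogonal projection is solvable and keeps the order of accuracy. -/
theorem exists_qoStep_of_isBigO (hR : ContDiff ℝ ∞ (Function.uncurry R)) (hG : ContDiff ℝ ∞ G)
    (hp : 2 ≤ p) {κ : ℝ} (hκ : 0 < κ)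
    (hσ : ∀ᶠ h in 𝓝[>] (0 : ℝ), κ * h ≤ ‖M.gradS R G t q h‖)
    (hΔ : (fun h => G (M.step R t q h) - G q) =O[𝓝[>] 0]
      fun h : ℝ => h ^ (p + 1) * ‖M.gradS R G t q h‖)
    (he : (fun h => M.step R t q h - y (t + h)) =O[𝓝[>] 0] fun h : ℝ => h ^ (p + 1)) :
    ∃ h > 0, ∃ δ > 0, ∃ C > 0, ∀ Δt ∈ Set.Ioc (0 : ℝ) h,
      M.gradS R G t q Δt ≠ 0 ∧
      ∃ μ : ℝ, |μ| ≤ δ * Δt ∧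
        G (M.qoStep R G t q Δt μ) = G q ∧
        (∀ ν : ℝ, |ν| ≤ δ * Δt → G (M.qoStep R G t q Δt ν) = G q → ν = μ) ∧
        ‖M.qoStep R G t q Δt μ - y (t + Δt)‖ ≤ C * Δt ^ (p + 1) := by
  obtain ⟨K, hK, hKO⟩ := (((contDiff_gradient hG).contDiffAt (x := q)).hasStrictFDerivAt
    (by simp)).isBigO_sub.exists_pos
  obtain ⟨ε, hε, hball⟩ := Metric.eventually_nhds_iff.1 hKO.bound
  obtain ⟨A, hA, hAO⟩ := hΔ.exists_pos
  obtain ⟨B, hB, hBO⟩ := he.exists_pos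
  -- With `K` a Lipschitz constant of the gradient near `q`, the slope drops by at most `K δ h = κ h
  -- / 2 ≤ σ / 2` over `|μ| ≤ δ h`.
  set δ := κ / (2 * K) with hδ
  have hδ0 : 0 < δ := by positivity
  have hKδ : K * δ = κ / 2 := by rw [hδ]; field_simp
  have e1 : ∀ᶠ h in 𝓝[>] (0 : ℝ), M.step R t q h ∈ Metric.ball q (ε / 2) :=
    ((M.tendsto_step hR).mono_left nhdsWithin_le_nhds).eventually
      (Metric.ball_mem_nhds q (by positivity))
  have e2 : ∀ᶠ h in 𝓝[>] (0 : ℝ), δ * h < ε / 2 := by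
    have : Tendsto (fun h : ℝ => δ * h) (𝓝 0) (𝓝 0) := by simpa using tendsto_time (t := 0) δ
    exact (this.mono_left nhdsWithin_le_nhds).eventually_lt_const (by positivity)
  -- This makes the defect `A h ^ (p + 1) σ` at most `(σ / 2) (δ h)`, the range reached with slope
  -- `σ / 2`.
  have e3 : ∀ᶠ h in 𝓝[>] (0 : ℝ), A * h ^ p < δ / 2 := by
    have hcont : Continuous fun h : ℝ => A * h ^ p := by fun_prop
    have : Tendsto (fun h : ℝ => A * h ^ p) (𝓝 0) (𝓝 0) := by
      simpa [show p ≠ 0 by omega] using hcont.tendsto 0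
    exact (this.mono_left nhdsWithin_le_nhds).eventually_lt_const (by positivity)
  obtain ⟨h₀, hh₀, hsub⟩ := mem_nhdsGT_iff_exists_Ioc_subset.1
    (e1.and (e2.and (e3.and (hσ.and (hAO.bound.and hBO.bound)))))
  refine ⟨h₀, hh₀, δ, hδ0, B + 2 * A, by positivity, fun h hh => ?_⟩
  obtain ⟨f1, f2, f3, f4, f5, f6⟩ := hsub hh
  have hh0 : 0 < h := hh.1
  set σ := ‖M.gradS R G t q h‖ with hσdef
  have hσ0 : 0 < σ := lt_of_lt_of_le (by positivity) f4
  refine ⟨norm_pos_iff.1 hσ0, ?_⟩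
  set v := σ⁻¹ • M.gradS R G t q h with hv
  have hv1 : ‖v‖ = 1 := by
    rw [hv, norm_smul, norm_inv, norm_norm, ← hσdef, inv_mul_cancel₀ hσ0.ne']
  have hgv : inner ℝ (gradient G (M.step R t q h)) v = σ := by
    rw [hv, real_inner_smul_right, M.inner_gradient_gradS, ← hσdef]
    field_simp
  have hq : ∀ μ, M.qoStep R G t q h μ = M.step R t q h + μ • v := fun μ => rfl
  rw [Real.norm_of_nonneg (by positivity : 0 ≤ h ^ (p + 1) * σ), Real.norm_eq_abs] at f5
  rw [Real.norm_of_nonneg (by positivity : 0 ≤ h ^ (p + 1))] at f6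
  have hder : ∀ μ, HasDerivAt (fun μ => G (M.qoStep R G t q h μ))
      (inner ℝ (gradient G (M.qoStep R G t q h μ)) v) μ := by
    intro μ
    have h1 : HasDerivAt (fun μ : ℝ => M.qoStep R G t q h μ) v μ := by
      simp only [hq]
      simpa using ((hasDerivAt_id μ).smul_const v).const_add (M.step R t q h)
    rw [inner_gradient_left]
    exact (hG.differentiable (by simp) _).hasFDerivAt.comp_hasDerivAt μ h1
  have hlow : ∀ μ, |μ| ≤ δ * h → σ / 2 ≤ inner ℝ (gradient G (M.qoStep R G t q h μ)) v := by
    intro μ hμ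
    have h1 : ‖μ • v‖ = |μ| := by rw [norm_smul, hv1, mul_one, Real.norm_eq_abs]
    rw [mem_ball_iff_norm] at f1
    have h2 := hball (y := (M.qoStep R G t q h μ, M.step R t q h)) (by
      rw [Prod.dist_eq, max_lt_iff, dist_eq_norm, dist_eq_norm]
      refine ⟨?_, by simpa using f1.trans (half_lt_self hε)⟩
      rw [hq, add_sub_right_comm]
      exact (norm_add_le _ _).trans_lt (by rw [h1]; linarith))
    simp only [hq μ, add_sub_cancel_left, h1] at h2
    have h3 := abs_real_inner_le_norm
      (gradient G (M.step R t q h + μ • v) - gradient G (M.step R t q h)) v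
    rw [hv1, mul_one, inner_sub_left, hgv] at h3
    have h4 : K * |μ| ≤ κ * h / 2 := by
      calc K * |μ| ≤ K * (δ * h) := by gcongr
        _ = κ * h / 2 := by rw [← mul_assoc, hKδ]; ring
    have h5 := (abs_le.1 (h3.trans (h2.trans h4))).1
    rw [hq]
    linarith
  have hval : |G (M.qoStep R G t q h 0) - G q| ≤ A * (h ^ (p + 1) * σ) := by
    simpa [hq] using f5
  obtain ⟨μ, hμ, hμ0, huniq, hsize⟩ := exists_unique_root_of_le_deriv (a := G q)
    (by positivity : 0 ≤ δ * h) (half_pos hσ0) (fun μ _ => hder μ) hlow (hval.trans (by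
      calc A * (h ^ (p + 1) * σ) = (A * h ^ p) * (h * σ) := by ring
        _ ≤ δ / 2 * (h * σ) := by gcongr
        _ = σ / 2 * (δ * h) := by ring))
  refine ⟨μ, hμ, hμ0, huniq, ?_⟩
  have hμp : |μ| ≤ 2 * A * h ^ (p + 1) := by
    have h1 := hsize.trans hval
    refine le_of_mul_le_mul_left ?_ (half_pos hσ0)
    calc σ / 2 * |μ| ≤ A * (h ^ (p + 1) * σ) := h1
      _ = _ := by ring
  calc ‖M.qoStep R G t q h μ - y (t + h)‖
      = ‖(M.step R t q h - y (t + h)) + μ • v‖ := by rw [hq]; congr 1; abel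
    _ ≤ ‖M.step R t q h - y (t + h)‖ + ‖μ • v‖ := norm_add_le _ _
    _ ≤ B * h ^ (p + 1) + 2 * A * h ^ (p + 1) := by
        rw [norm_smul μ v, hv1, mul_one, Real.norm_eq_abs]; gcongr
    _ = _ := by ring

theorem le_norm_gradS_of_relaxation
    (hrelax : (fun h : ℝ => inner ℝ (gradient G (M.step R t q h)) (M.step R t q h - q)
      / ‖M.step R t q h - q‖ - c * h) =O[𝓝[>] 0] fun h : ℝ => h ^ 2)
    (hc : c ≠ 0) :
    ∀ᶠ h in 𝓝[>] (0 : ℝ), |c| / 2 * h ≤ ‖M.gradS R G t q h‖ := by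
  have h1 := hrelax.trans_isLittleO
    ((isLittleO_pow_id (𝕜 := ℝ) one_lt_two).mono nhdsWithin_le_nhds)
  filter_upwards [h1.def (half_pos (abs_pos.2 hc)), self_mem_nhdsWithin] with h hh hpos
  have hpos' : 0 < h := hpos
  have h2 : |inner ℝ (gradient G (M.step R t q h)) (M.step R t q h - q)
      / ‖M.step R t q h - q‖| ≤ ‖M.gradS R G t q h‖ := by
    rw [abs_div, abs_norm]
    exact div_le_of_le_mul₀ (norm_nonneg _) (norm_nonneg _)
      (M.abs_inner_gradient_le h (M.step_sub_mem_stageSpan h))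
  rw [Real.norm_eq_abs, Real.norm_of_nonneg hpos'.le] at hh
  have h3 : |c * h| - |inner ℝ (gradient G (M.step R t q h)) (M.step R t q h - q)
      / ‖M.step R t q h - q‖| ≤ |c| / 2 * h :=
    (abs_sub_abs_le_abs_sub _ _).trans (by rwa [abs_sub_comm])
  rw [abs_mul, abs_of_pos hpos'] at h3
  linarith

/-- Dividing `o (h ^ (k + 2))` by an increment of size at least `h ^ (k + 1)` leaves `o (h)`,
incompatible with a nonzero linear term `c * h`. -/
theorem eq_zero_of_relaxation {k : ℕ}
    (hrelax : (fun h : ℝ => inner ℝ (gradient G (M.step R t q h)) (M.step R t q h - q)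
      / ‖M.step R t q h - q‖ - c * h) =O[𝓝[>] 0] fun h : ℝ => h ^ 2)
    (hu : (fun h : ℝ => h ^ (k + 1)) =O[𝓝[>] 0] fun h => M.step R t q h - q)
    (hg : (fun h => inner ℝ (gradient G (M.step R t q h)) (M.step R t q h - q))
      =o[𝓝[>] 0] fun h : ℝ => h ^ (k + 2)) : c = 0 := by
  have hpos : ∀ᶠ h in 𝓝[>] (0 : ℝ), h ≠ 0 := eventually_mem_nhdsWithin.mono fun h hh => ne_of_gt hh
  have h1 : (fun h => ‖M.step R t q h - q‖⁻¹) =O[𝓝[>] 0] fun h : ℝ => (h ^ (k + 1))⁻¹ :=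
    hu.norm_right.inv_rev (hpos.mono fun h hh h0 => absurd h0 (pow_ne_zero _ hh))
  have h2 : (fun h => inner ℝ (gradient G (M.step R t q h)) (M.step R t q h - q)
      / ‖M.step R t q h - q‖) =o[𝓝[>] 0] fun h : ℝ => h := by
    refine (hg.mul_isBigO h1).congr' (Eventually.of_forall fun h => (div_eq_mul_inv _ _).symm)
      (hpos.mono fun h hh => ?_)
    field_simp
    ring
  have h3 := h2.sub (hrelax.trans_isLittleO
    ((isLittleO_pow_id (𝕜 := ℝ) one_lt_two).mono nhdsWithin_le_nhds))
  by_contra hc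
  have h4 : (fun h : ℝ => h) =o[𝓝[>] 0] fun h : ℝ => h := by
    refine (isLittleO_const_mul_left_iff hc).1 (h3.congr_left fun h => ?_)
    ring
  exact isLittleO_irrefl hpos.frequently h4

end ExplicitRK

end QuasiOrthogonal

/-! ### Defect bounds according to the vanishing order of the field. -/

section OrderKept

variable {s m : ℕ} {R : ℝ → EuclideanSpace ℝ (Fin m) → EuclideanSpace ℝ (Fin m)}
  {G : EuclideanSpace ℝ (Fin m) → ℝ} {T t c : ℝ} {q : EuclideanSpace ℝ (Fin m)}
  {y : ℝ → EuclideanSpace ℝ (Fin m)} {p : ℕ}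

namespace ExplicitRK

variable (M : ExplicitRK s)

theorem isBigO_gradient_step_sub (hR : ContDiff ℝ ∞ (Function.uncurry R)) (hG : ContDiff ℝ ∞ G) :
    (fun h => gradient G (M.step R t q h) - gradient G q) =O[𝓝[>] 0]
      fun h => M.step R t q h - q :=
  (((contDiff_gradient hG).differentiable (by simp) q).isBigO_sub).comp_tendsto
    ((M.tendsto_step hR).mono_left nhdsWithin_le_nhds)

/-- The increment of the method has the size of the leading term of the solution. -/
theorem pow_isBigO_step_sub (hR : ContDiff ℝ ∞ (Function.uncurry R))
    (hy : IsLocalSolution R t q y)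
    (he : (fun h => M.step R t q h - y (t + h)) =O[𝓝[>] 0] fun h : ℝ => h ^ (p + 1))
    {k : ℕ} (hk : k < p) {r : EuclideanSpace ℝ (Fin m)} (hr : r ≠ 0)
    (hρ : (fun τ => R (t + τ) q - τ ^ k • r) =O[𝓝 0] fun τ : ℝ => τ ^ (k + 1)) :
    (fun h : ℝ => h ^ (k + 1)) =O[𝓝[>] 0] fun h => M.step R t q h - q := by
  have hk0 : ((k : ℝ) + 1) ≠ 0 := by positivity
  -- Since `k < p`, the error of the method is of higher order than the leading term `h ^ (k + 1)`
  -- and cannot cancel it.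
  have h1 := he.trans ((isBigO_pow_pow_of_le (show k + 2 ≤ p + 1 by omega)).mono
    nhdsWithin_le_nhds)
  have h2 := h1.add ((hy.isBigO_sub_leading hR hρ).mono nhdsWithin_le_nhds)
  have h3 : (fun h : ℝ => h ^ (k + 1)) =O[𝓝[>] 0] fun h : ℝ => (h ^ (k + 1) / (k + 1)) • r := by
    refine IsBigO.of_bound (((k : ℝ) + 1) / ‖r‖) (Eventually.of_forall fun h => ?_)
    have hr' : ‖r‖ ≠ 0 := norm_ne_zero_iff.2 hr
    rw [norm_smul, norm_div, Real.norm_of_nonneg (by positivity : (0 : ℝ) ≤ k + 1)]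
    apply le_of_eq
    field_simp
  have h4 := h2.trans_isLittleO (((isLittleO_pow_pow (𝕜 := ℝ) (show k + 1 < k + 2 by omega)).mono
    nhdsWithin_le_nhds).trans_isBigO h3)
  refine h3.trans (h4.right_isBigO_add.congr_right fun h => ?_)
  abel

/-- `G` is locally Lipschitz and constant along the exact solution. -/
theorem isBigO_defect (hinv : IsInvariantOf R G T) (ht : t ∈ Set.Ico 0 T)
    (hR : ContDiff ℝ ∞ (Function.uncurry R)) (hG : ContDiff ℝ ∞ G)
    (hy : IsLocalSolution R t q y) :
    (fun h => G (M.step R t q h) - G q) =O[𝓝[>] 0] fun h => M.step R t q h - y (t + h) := by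
  have h1 : Tendsto (fun h => (M.step R t q h, y (t + h))) (𝓝[>] 0) (𝓝 (q, q)) :=
    ((M.tendsto_step hR).prodMk_nhds hy.tendsto).mono_left nhdsWithin_le_nhds
  refine (((hG.contDiffAt (x := q)).hasStrictFDerivAt
    (by simp)).isBigO_sub.comp_tendsto h1).congr' ?_ EventuallyEq.rfl
  filter_upwards [hinv.eventually_eq ht hG hy] with h hh
  simp [hh]

/-- The stage contributes `c_i` times the inner product and the moving gradient contributes `-∑ b_j`
times it, by the differentiated invariance identity; the time derivative drops out. -/
theorem hasDerivAt_inner_gradient_stage (hinv : IsInvariantOf R G T) (ht : t ∈ Set.Ico 0 T)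
    (hR : ContDiff ℝ ∞ (Function.uncurry R)) (hG : ContDiff ℝ ∞ G) (i : Fin s) :
    HasDerivAt (fun h => inner ℝ (gradient G (M.step R t q h)) (M.stage R t q h i))
      ((M.c i - ∑ j, M.b j) *
        inner ℝ (gradient G q) (fderiv ℝ (Function.uncurry R) (t, q) (0, R t q))) 0 := by
  have h1 : HasDerivAt (fun h => M.step R t q h) ((∑ j, M.b j) • R t q) 0 :=
    (M.hasDerivAt_smul_sum_stage hR M.b).const_add q
  have h2 : HasFDerivAt (gradient G) (fderiv ℝ (gradient G) q) (M.step R t q 0) := by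
    rw [step_zero]
    exact ((contDiff_gradient hG).differentiable (by simp) q).hasFDerivAt
  refine ((h2.comp_hasDerivAt (0 : ℝ) h1).inner ℝ (M.hasDerivAt_stage hR i)).congr_deriv ?_
  have h3 : ((M.c i, M.c i • R t q) : ℝ × EuclideanSpace ℝ (Fin m)) =
      M.c i • ((1 : ℝ), (0 : EuclideanSpace ℝ (Fin m))) + M.c i • ((0 : ℝ), R t q) := by simp
  have h4 := hinv.inner_fderiv_time (q := q) ht hR
  have h5 := hinv.inner_fderiv_space (q := q) ht hR hG (R t q)
  rw [Function.comp_apply, step_zero, stage_zero, h3, map_add, map_smul, map_smul, map_smul,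
    inner_add_right, real_inner_smul_right, real_inner_smul_right, real_inner_smul_left, h4]
  linear_combination (∑ j, M.b j) * h5

/-- If the increment of the method has size at least `h` and the relaxation condition holds, then
the projected gradient stays away from zero. -/
theorem exists_le_norm_gradS (hinv : IsInvariantOf R G T) (ht : t ∈ Set.Ico 0 T)
    (hR : ContDiff ℝ ∞ (Function.uncurry R)) (hG : ContDiff ℝ ∞ G)
    (hMc : ∃ i, M.c i ≠ 0) (hc : c ≠ 0)
    (hrelax : (fun h : ℝ => inner ℝ (gradient G (M.step R t q h)) (M.step R t q h - q)
      / ‖M.step R t q h - q‖ - c * h) =O[𝓝[>] 0] fun h : ℝ => h ^ 2)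
    (hu : (fun h : ℝ => h ^ (0 + 1)) =O[𝓝[>] 0] fun h => M.step R t q h - q) :
    ∃ κ > 0, ∀ᶠ h in 𝓝[>] (0 : ℝ), κ ≤ ‖M.gradS R G t q h‖ := by
  set κ₀ := inner ℝ (gradient G q) (fderiv ℝ (Function.uncurry R) (t, q) (0, R t q)) with hκ₀
  have hω := M.hasDerivAt_inner_gradient_stage (q := q) hinv ht hR hG
  have hg0 : inner ℝ (gradient G q) (R t q) = 0 := hinv t ⟨ht.1, ht.2.le⟩ q
  -- If `κ₀ = 0`, every stage has gradient component `o (h)`, so the increment has `o (h ^ 2)`,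
  -- which the relaxation condition excludes.
  have hne : κ₀ ≠ 0 := by
    intro h0
    refine hc (M.eq_zero_of_relaxation (k := 0) hrelax hu ?_)
    have h1 : (fun h : ℝ => ∑ j, M.b j *
        inner ℝ (gradient G (M.step R t q h)) (M.stage R t q h j)) =o[𝓝[>] 0] fun h => h := by
      refine IsLittleO.fun_sum fun j _ => IsLittleO.const_mul_left ?_ _
      have h2 := hasDerivAt_iff_isLittleO.1 (hω j)
      rw [← hκ₀, h0, step_zero, stage_zero, hg0] at h2
      simpa using h2.mono nhdsWithin_le_nhds
    refine ((isBigO_refl (fun h : ℝ => h) _).mul_isLittleO h1).congr (fun h => ?_)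
      fun h => by ring
    rw [step_sub, real_inner_smul_right, inner_sum]
    simp only [real_inner_smul_right]
  obtain ⟨i, hi⟩ := hMc
  -- The first stage of an explicit method has abscissa `0`. Subtracting it cancels `∑ b_j` and the
  -- zeroth-order part of stage `i`, leaving a vector of size `O (h)` with gradient component `c_i
  -- κ₀ h + o (h)`.
  set i₀ : Fin s := ⟨0, i.pos⟩ with hi₀
  have hci₀ : M.c i₀ = 0 :=
    Finset.sum_eq_zero fun j _ => M.explicit i₀ j (Nat.zero_le _)
  have hw := ((M.hasDerivAt_stage (t := t) (q := q) hR i).sub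
    (M.hasDerivAt_stage (t := t) (q := q) hR i₀)).isBigO_sub
  obtain ⟨C, hC, hwC⟩ := hw.exists_pos
  have hd := ((hω i).sub (hω i₀))
  have ha : (M.c i - ∑ j, M.b j) * κ₀ - (M.c i₀ - ∑ j, M.b j) * κ₀ = M.c i * κ₀ := by
    rw [hci₀]; ring
  rw [← hκ₀, ha] at hd
  have hpos : 0 < |M.c i * κ₀| := abs_pos.2 (mul_ne_zero hi hne)
  have hd' := (hasDerivAt_iff_isLittleO.1 hd).def (half_pos hpos)
  refine ⟨|M.c i * κ₀| / (2 * C), by positivity, ?_⟩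
  filter_upwards [nhdsWithin_le_nhds hd', nhdsWithin_le_nhds hwC.bound, self_mem_nhdsWithin]
    with h h1 h2 h3
  have h3' : 0 < h := h3
  simp only [Pi.sub_apply, step_zero, stage_zero, hg0, sub_zero, smul_eq_mul,
    Real.norm_eq_abs, sub_self, abs_of_pos h3'] at h1 h2
  rw [← inner_sub_right] at h1
  have h4 := M.abs_inner_gradient_le (G := G) h
    (Submodule.sub_mem _ (M.stage_mem_stageSpan (R := R) (t := t) (q := q) h i)
      (M.stage_mem_stageSpan h i₀))
  have h5 : |h * (M.c i * κ₀)| - |inner ℝ (gradient G (M.step R t q h))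
      (M.stage R t q h i - M.stage R t q h i₀)| ≤ |M.c i * κ₀| / 2 * h :=
    (abs_sub_abs_le_abs_sub _ _).trans (by rwa [abs_sub_comm])
  rw [abs_mul, abs_of_pos h3'] at h5
  have h6 : |M.c i * κ₀| / 2 * h ≤ ‖M.gradS R G t q h‖ * (C * h) := by
    calc |M.c i * κ₀| / 2 * h ≤ ‖M.gradS R G t q h‖ *
          ‖M.stage R t q h i - M.stage R t q h i₀‖ := by linarith
      _ ≤ ‖M.gradS R G t q h‖ * (C * h) := by gcongr
  rw [div_le_iff₀ (by positivity)]
  refine le_of_mul_le_mul_right ?_ h3'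
  linear_combination 2 * h6

/-- If the field is `O (τ ^ k)` in time at the initial point with `k ≥ 1`, and the increment of the
method is `O (h ^ (k + 1))`, then its component along the gradient is `o (h ^ (k + 2))`. -/
theorem isLittleO_inner_gradient_step_sub (hinv : IsInvariantOf R G T) (ht : t ∈ Set.Ico 0 T)
    (hR : ContDiff ℝ ∞ (Function.uncurry R)) (hG : ContDiff ℝ ∞ G) {k : ℕ} (hk : 1 ≤ k)
    (hρ : (fun τ => R (t + τ) q) =O[𝓝 0] fun τ : ℝ => τ ^ k)
    (hu : (fun h => M.step R t q h - q) =O[𝓝[>] 0] fun h : ℝ => h ^ (k + 1)) :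
    (fun h => inner ℝ (gradient G (M.step R t q h)) (M.step R t q h - q))
      =o[𝓝[>] 0] fun h : ℝ => h ^ (k + 2) := by
  have hR0 : R t q = 0 := by
    obtain ⟨C, hC⟩ := hρ.bound
    have := hC.self_of_nhds
    simpa [show k ≠ 0 by omega] using this
  -- The squared increment is small enough precisely because `k ≥ 1`.
  have hle : (fun h : ℝ => h ^ (k + 1 + (k + 1))) =O[𝓝[>] 0] fun h : ℝ => h ^ (k + 2 + 1) :=
    (isBigO_pow_pow_of_le (by omega)).mono nhdsWithin_le_nhds
  have h1 : (fun h => inner ℝ (gradient G q) (M.step R t q h - q)) =O[𝓝[>] 0]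
      fun h : ℝ => h ^ (k + 2 + 1) := by
    have h2 : (fun h : ℝ => ∑ j, M.b j * inner ℝ (gradient G q) (M.stage R t q h j)) =O[𝓝[>] 0]
        fun h : ℝ => h ^ (k + 2) :=
      IsBigO.fun_sum fun j _ => IsBigO.const_mul_left
        ((M.isBigO_inner_stage hinv ht hR hG hR0 hρ j).mono nhdsWithin_le_nhds) _
    refine ((isBigO_refl (fun h : ℝ => h) _).mul h2).congr (fun h => ?_) fun h => by ring
    rw [step_sub, real_inner_smul_right, inner_sum]
    simp only [real_inner_smul_right]
  have h3 : (fun h => inner ℝ (gradient G (M.step R t q h) - gradient G q)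
      (M.step R t q h - q)) =O[𝓝[>] 0] fun h : ℝ => h ^ (k + 2 + 1) := by
    refine IsBigO.trans ?_ hle
    refine (IsBigO.of_norm_le fun h => norm_inner_le_norm _ _).trans ?_
    refine (((M.isBigO_gradient_step_sub hR hG).trans hu).norm_left.mul hu.norm_left).congr_right
      fun h => by ring
  refine ((h1.add h3).congr_left fun h => ?_).trans_isLittleO
    ((isLittleO_pow_pow (by omega)).mono nhdsWithin_le_nhds)
  rw [← inner_add_left, add_sub_cancel]

/-- The defect of the invariant, when the increment of the method is itself of the size of the
error. -/
theorem isBigO_defect_of_isBigO_step_sub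
    (hR : ContDiff ℝ ∞ (Function.uncurry R)) (hG : ContDiff ℝ ∞ G)
    (hσ : (fun h : ℝ => h) =O[𝓝[>] 0] fun h => ‖M.gradS R G t q h‖)
    (hu : (fun h => M.step R t q h - q) =O[𝓝[>] 0] fun h : ℝ => h ^ (p + 1)) :
    (fun h => G (M.step R t q h) - G q) =O[𝓝[>] 0]
      fun h : ℝ => h ^ (p + 1) * ‖M.gradS R G t q h‖ := by
  have hsq : (fun h => ‖M.step R t q h - q‖ * ‖M.step R t q h - q‖) =O[𝓝[>] 0]
      fun h : ℝ => h ^ (p + 1) * ‖M.gradS R G t q h‖ := by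
    -- One factor keeps the full power `h ^ (p + 1)`; the other is only used as `O (h)`, hence `O
    -- (‖∇G_s‖)`.
    refine hu.norm_left.mul (hu.norm_left.trans (IsBigO.trans ?_ hσ))
    simpa using (isBigO_pow_pow_of_le (show 1 ≤ p + 1 by omega)).mono nhdsWithin_le_nhds
  have htend : Tendsto (fun h => (M.step R t q h, q)) (𝓝[>] 0) (𝓝 (q, q)) :=
    ((M.tendsto_step hR).mono_left nhdsWithin_le_nhds).prodMk_nhds tendsto_const_nhds
  have h1 : (fun h => G (M.step R t q h) - G q - inner ℝ (gradient G q) (M.step R t q h - q))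
      =O[𝓝[>] 0] fun h : ℝ => h ^ (p + 1) * ‖M.gradS R G t q h‖ := by
    refine (((hG.isBigO_sub_sub_fderiv q).comp_tendsto htend).congr (fun h => ?_)
      fun h => ?_).trans hsq
    · rw [inner_gradient_left]; rfl
    · simp
  have h2 : (fun h => inner ℝ (gradient G (M.step R t q h)) (M.step R t q h - q))
      =O[𝓝[>] 0] fun h : ℝ => h ^ (p + 1) * ‖M.gradS R G t q h‖ := by
    refine (IsBigO.of_bound 1 (Eventually.of_forall fun h => ?_)).trans
      (hu.norm_left.mul (isBigO_refl (fun h => ‖M.gradS R G t q h‖) _))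
    simpa [mul_comm] using M.abs_inner_gradient_le (G := G) h (M.step_sub_mem_stageSpan h)
  have h3 : (fun h => inner ℝ (gradient G (M.step R t q h) - gradient G q)
      (M.step R t q h - q)) =O[𝓝[>] 0] fun h : ℝ => h ^ (p + 1) * ‖M.gradS R G t q h‖ := by
    refine IsBigO.trans ?_ hsq
    exact (IsBigO.of_norm_le fun h => norm_inner_le_norm _ _).trans
      ((M.isBigO_gradient_step_sub hR hG).norm_norm.mul (isBigO_refl _ _))
  -- Moving the gradient from `q` to the new point costs a quadratic term, but only there does its
  -- inner product with the increment carry the factor `‖∇G_s‖`.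
  refine ((h1.add h2).sub h3).congr_left fun h => ?_
  rw [inner_sub_left]
  ring

end ExplicitRK

end OrderKept

theorem mainTheorem2 {s m : ℕ} (M : ExplicitRK s) (p : ℕ) (hp : 2 ≤ p) (hM : M.HasOrder p)
    (R : ℝ → EuclideanSpace ℝ (Fin m) → EuclideanSpace ℝ (Fin m))
    (hR : ContDiff ℝ ∞ (Function.uncurry R))
    (G : EuclideanSpace ℝ (Fin m) → ℝ) (hG : ContDiff ℝ ∞ G)
    (T : ℝ) (hinv : IsInvariantOf R G T)
    (tn : ℝ) (htn : tn ∈ Set.Ico 0 T) (qn : EuclideanSpace ℝ (Fin m))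
    (c : ℝ) (hc : c ≠ 0)
    (hrelax : (fun Δt : ℝ =>
        inner ℝ (gradient G (M.step R tn qn Δt)) (M.step R tn qn Δt - qn)
          / ‖M.step R tn qn Δt - qn‖ - c * Δt) =O[𝓝[>] 0] fun Δt : ℝ => Δt ^ 2)
    (y : ℝ → EuclideanSpace ℝ (Fin m)) (hy : IsLocalSolution R tn qn y) :
    ∃ h > 0, ∃ δ > 0, ∃ C > 0, ∀ Δt ∈ Set.Ioc (0 : ℝ) h,
      M.gradS R G tn qn Δt ≠ 0 ∧
      ∃ μ : ℝ, |μ| ≤ δ * Δt ∧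
        G (M.qoStep R G tn qn Δt μ) = G qn ∧
        (∀ ν : ℝ, |ν| ≤ δ * Δt → G (M.qoStep R G tn qn Δt ν) = G qn → ν = μ) ∧
        ‖M.qoStep R G tn qn Δt μ - y (tn + Δt)‖ ≤ C * Δt ^ (p + 1) := by
  have he := hM m R hR tn qn y hy
  have hκ : 0 < |c| / 2 := half_pos (abs_pos.2 hc)
  have hσ := M.le_norm_gradS_of_relaxation hrelax hc
  have hρs : ContDiff ℝ ∞ fun τ => R (tn + τ) qn :=
    hR.comp (f := fun τ : ℝ => (tn + τ, qn)) (by fun_prop)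
  refine M.exists_qoStep_of_isBigO hR hG hp hκ hσ ?_ he
  rcases isBigO_pow_or_exists_leading_term p hρs with hρ | ⟨k, hk, r, hr, hρ⟩
  · have hz := (hy.isBigO_sub hR hρ).mono (nhdsWithin_le_nhds (s := Set.Ioi 0))
    have hσO : (fun h : ℝ => h) =O[𝓝[>] 0] fun h => ‖M.gradS R G tn qn h‖ := by
      refine IsBigO.of_bound (|c| / 2)⁻¹ ?_
      filter_upwards [hσ, self_mem_nhdsWithin] with h hh hpos
      rw [Real.norm_of_nonneg (le_of_lt hpos), norm_norm, inv_mul_eq_div, le_div_iff₀' hκ]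
      exact hh
    exact M.isBigO_defect_of_isBigO_step_sub hR hG hσO
      ((he.add hz).congr_left fun h => sub_add_sub_cancel _ _ _)
  · have hlow := M.pow_isBigO_step_sub hR hy he hk hr hρ
    rcases Nat.eq_zero_or_pos k with rfl | hk1
    · obtain ⟨κ, hκ0, hκσ⟩ := M.exists_le_norm_gradS hinv htn hR hG (hM.exists_c_ne_zero hp) hc
        hrelax hlow
      refine ((M.isBigO_defect hinv htn hR hG hy).trans he).trans (IsBigO.of_bound κ⁻¹ ?_)
      filter_upwards [hκσ] with h hh
      rw [norm_mul, norm_norm, mul_left_comm]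
      refine le_mul_of_one_le_right (norm_nonneg _) ?_
      rw [inv_mul_eq_div, one_le_div hκ0]
      exact hh
    -- The intermediate orders `1 ≤ k < p` cannot occur under the relaxation condition.
    · refine absurd (M.eq_zero_of_relaxation hrelax hlow ?_) hc
      have hρk : (fun τ => R (tn + τ) qn) =O[𝓝 0] fun τ : ℝ => τ ^ k := by
        have h1 : (fun τ : ℝ => τ ^ k • r) =O[𝓝 0] fun τ : ℝ => τ ^ k :=
          IsBigO.of_bound ‖r‖ (Eventually.of_forall fun τ => by rw [norm_smul, mul_comm])
        exact ((hρ.trans (isBigO_pow_pow_of_le (by omega))).add h1).congr_left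
          fun τ => sub_add_cancel _ _
      refine M.isLittleO_inner_gradient_step_sub hinv htn hR hG hk1 hρk ?_
      refine ((he.trans ((isBigO_pow_pow_of_le (by omega)).mono nhdsWithin_le_nhds)).add
        ((hy.isBigO_sub hR hρk).mono nhdsWithin_le_nhds)).congr_left fun h => ?_
      exact sub_add_sub_cancel _ _ _
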